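/- Let $l$ be a prime, $K$ a number field with algebraic closure $\overline{K}$, $G_K=\mathrm{Gal}(\overline{K}/K)$ and $\chi_c: G_K\to\mathbb{Z}_l^\times$ the $l$-adic cyclotomic character. Let $n\neq 0$ be an integer, $V_l$ a finite-dimensional $\mathbb{Q}_l$-vector space with a nondegenerate $(-1)^n$-symmetric bilinear form $\psi_l$, and $\rho_l: G_K\to \mathrm{GL}(V_l)$ a continuous representation for which $\psi_l: V_l\times V_l\to\mathbb{Q}_l(-n)$ is $G_K$-equivariant, i.e. $\psi_l(\rho_l(\sigma)v,\rho_l(\sigma)w)=\chi_c(\sigma)^{-n}\psi_l(v,w)$. (This includes the case $V_l=V\otimes_{\mathbb{Q}}\mathbb{Q}_l$, $\psi_l=\psi\otimes_{\mathbb{Q}}\mathbb{Q}_l$, where $(V,\psi)$ is a rational polarized pure Hodge structure of weight $n$ and $(\rho_l)_l$ is a strictly compatible family of representations of Hodge–Tate type on the $V_l$ respecting the forms $\psi_l$ as above.) Let $\mathrm{GIso}_{(V_l,\psi_l)}$ be the group of $g\in \mathrm{GL}_{V_l}$ with $\psi_l(gv,gw)=\chi(g)\psi_l(v,w)$ for some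 scalar $\chi(g)\in\mathbb{G}_m$, and $\mathrm{Iso}_{(V_l,\psi_l)}$ the subgroup preserving $\psi_l$; both are algebraic groups over $\mathbb{Q}_l$. For a finite extension $L/K$ inside $\overline{K}$, let $G^{\mathrm{alg}}_{l,L}$ be the Zariski closure of $\rho_l(G_L)$ in $\mathrm{GIso}_{(V_l,\psi_l)}$ and put $G^{\mathrm{alg}}_{l,L,1}=G^{\mathrm{alg}}_{l,L}\cap \mathrm{Iso}_{(V_l,\psi_l)}$. Let $L/K$ be a finite Galois extension inside $\overline{K}$. Then $G^{\mathrm{alg}}_{l,L}$ and $G^{\mathrm{alg}}_{l,L,1}$ are normal subgroups of $G^{\mathrm{alg}}_{l,K}$ and $G^{\mathrm{alg}}_{l,K,1}$ respectively, and the natural map $$ i_{L/K}:\; G^{\mathrm{alg}}_{l,K,1}/G^{\mathrm{alg}}_{l,L,1}\longrightarrow G^{\mathrm{alg}}_{l,K}/G^{\mathrm{alg}}_{l,L} $$ is an isomorphism of finite groups; moreover $$ (G^{\mathrm{alg}}_{l,L})^\circ=(G^{\mathrm{alg}}_{l,K})^\circ \quad\text{and}\quad (G^{\mathrm{alg}}_{l,L,1})^\circ=(G^{\mathrm{alg}}_{l,K,1})^\circ.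 $$ (Here quotients and identity components are those of algebraic groups, i.e. computed on points over an arbitrary algebraically closed field $\Omega\supseteq\mathbb{Q}_l$.) -/

import Mathlib

open scoped TensorProduct

namespace SatoTate

noncomputable section

/-! ### Zariski closed subgroups of `GL_V` -/

section Coordinates

variable {ι R M : Type*} [CommRing R] [AddCommGroup M] [Module R M]

/-- The coordinates of `g ∈ GL(M)` with respect to a basis of `M`: the matrix entries of `g`
(left summand) and of `g⁻¹` (right summand). They generate the coordinate ring of `GL_n`. -/
def coords (b : Module.Basis ι R M) (g : LinearMap.GeneralLinearGroup R M) :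
    (ι × ι) ⊕ (ι × ι) → R :=
  Sum.elim (fun ij => b.repr (g.val (b ij.2)) ij.1) (fun ij => b.repr (g⁻¹.val (b ij.2)) ij.1)

lemma coords_inv (b : Module.Basis ι R M) (g : LinearMap.GeneralLinearGroup R M) :
    coords b g⁻¹ = coords b g ∘ Sum.swap := by
  funext x
  rcases x with x | x <;> simp [coords]

variable [Fintype ι]

lemma repr_mul (b : Module.Basis ι R M) (g h : LinearMap.GeneralLinearGroup R M) (i j : ι) :
    b.repr ((g * h).val (b j)) i =
      ∑ k, b.repr (g.val (b k)) i * b.repr (h.val (b j)) k := by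
  have : (g * h).val (b j) = g.val (∑ k, b.repr (h.val (b j)) k • b k) := by
    rw [b.sum_repr]; rfl
  rw [this]
  simp only [map_sum, map_smul, Finsupp.coe_finsetSum, Finset.sum_apply, Finsupp.coe_smul,
    Pi.smul_apply, smul_eq_mul, mul_comm]

/-- The comultiplication of the coordinate ring, in the left variable, with the coordinates of
the right factor substituted. -/
def mulRightPoly (y : (ι × ι) ⊕ (ι × ι) → R) :
    (ι × ι) ⊕ (ι × ι) → MvPolynomial ((ι × ι) ⊕ (ι × ι)) R :=
  Sum.elim
    (fun ij => ∑ k, MvPolynomial.X (Sum.inl (ij.1, k)) * MvPolynomial.C (y (Sum.inl (k, ij.2))))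
    (fun ij => ∑ k, MvPolynomial.C (y (Sum.inr (ij.1, k))) * MvPolynomial.X (Sum.inr (k, ij.2)))

/-- The same, in the right variable. -/
def mulLeftPoly (x : (ι × ι) ⊕ (ι × ι) → R) :
    (ι × ι) ⊕ (ι × ι) → MvPolynomial ((ι × ι) ⊕ (ι × ι)) R :=
  Sum.elim
    (fun ij => ∑ k, MvPolynomial.C (x (Sum.inl (ij.1, k))) * MvPolynomial.X (Sum.inl (k, ij.2)))
    (fun ij => ∑ k, MvPolynomial.X (Sum.inr (ij.1, k)) * MvPolynomial.C (x (Sum.inr (k, ij.2))))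

lemma coords_mul_right (b : Module.Basis ι R M) (g h : LinearMap.GeneralLinearGroup R M) :
    coords b (g * h) = fun i => MvPolynomial.eval (coords b g) (mulRightPoly (coords b h) i) := by
  funext x
  rcases x with ⟨i, j⟩ | ⟨i, j⟩
  · simp only [coords, mulRightPoly, Sum.elim_inl, map_sum, map_mul, MvPolynomial.eval_X,
      MvPolynomial.eval_C]
    exact repr_mul b g h i j
  · simp only [coords, mulRightPoly, Sum.elim_inr, map_sum, map_mul, MvPolynomial.eval_X,
      MvPolynomial.eval_C, mul_inv_rev]
    exact repr_mul b h⁻¹ g⁻¹ i j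

lemma coords_mul_left (b : Module.Basis ι R M) (g h : LinearMap.GeneralLinearGroup R M) :
    coords b (g * h) = fun i => MvPolynomial.eval (coords b h) (mulLeftPoly (coords b g) i) := by
  funext x
  rcases x with ⟨i, j⟩ | ⟨i, j⟩
  · simp only [coords, mulLeftPoly, Sum.elim_inl, map_sum, map_mul, MvPolynomial.eval_X,
      MvPolynomial.eval_C]
    exact repr_mul b g h i j
  · simp only [coords, mulLeftPoly, Sum.elim_inr, map_sum, map_mul, MvPolynomial.eval_X,
      MvPolynomial.eval_C, mul_inv_rev]
    exact repr_mul b h⁻¹ g⁻¹ i j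

end Coordinates

section Closure

variable (k : Type*) [Field k] (V : Type*) [AddCommGroup V] [Module k V] [FiniteDimensional k V]
variable (R : Type*) [CommRing R] [Algebra k R]

/-- `GL_V(R)`: the `R`-points of the group scheme `GL_V` over `k`. -/
abbrev GLPoints : Type _ := LinearMap.GeneralLinearGroup R (R ⊗[k] V)

variable {k V}

/-- The coordinates of a `k`-point of `GL_V`, with respect to a fixed basis of `V`. -/
def ptCoords (g : LinearMap.GeneralLinearGroup k V) := coords (Module.finBasis k V) g

variable {R}

/-- The coordinates of an `R`-point of `GL_V`, with respect to the same basis. -/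
def scalarCoords (g : GLPoints k V R) := coords ((Module.finBasis k V).baseChange R) g

/-- A polynomial over `R` is an `R`-linear combination of polynomials over `k`, with coefficients
in a `k`-basis of `R`. -/
lemma exists_descent {τ : Type*} (Q : MvPolynomial τ R) :
    ∃ q : Module.Free.ChooseBasisIndex k R →₀ MvPolynomial τ k,
      Q = q.sum fun i p => MvPolynomial.C (Module.Free.chooseBasis k R i) *
        MvPolynomial.map (algebraMap k R) p := by
  induction Q using MvPolynomial.induction_on' with
  | monomial m a =>
    refine ⟨((Module.Free.chooseBasis k R).repr a).mapRange (MvPolynomial.monomial m) (by simp), ?_⟩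
    rw [Finsupp.sum_mapRange_index (by simp)]
    conv_lhs => rw [← (Module.Free.chooseBasis k R).linearCombination_repr a,
      Finsupp.linearCombination_apply]
    simp only [Finsupp.sum, map_sum, MvPolynomial.map_monomial, MvPolynomial.C_mul_monomial]
    refine Finset.sum_congr rfl fun x _ => ?_
    rw [Algebra.smul_def, mul_comm]
  | add p q hp hq =>
    obtain ⟨q1, h1⟩ := hp
    obtain ⟨q2, h2⟩ := hq
    refine ⟨q1 + q2, ?_⟩
    rw [Finsupp.sum_add_index' (by simp) (by intros; simp [mul_add]), ← h1, ← h2]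

lemma eval_eq_zero_of_descent {τ : Type*} {S : Set (τ → k)} {y : τ → R}
    (hy : ∀ p : MvPolynomial τ k, (∀ s ∈ S, MvPolynomial.eval s p = 0) →
      MvPolynomial.aeval y p = 0)
    (Q : MvPolynomial τ R)
    (hQ : ∀ s ∈ S, MvPolynomial.eval (fun i => algebraMap k R (s i)) Q = 0) :
    MvPolynomial.eval y Q = 0 := by
  obtain ⟨q, rfl⟩ := exists_descent (k := k) Q
  have key : ∀ i, ∀ s ∈ S, MvPolynomial.eval s (q i) = 0 := by
    intro i s hs
    have h := hQ s hs
    simp only [Finsupp.sum, map_sum, map_mul, MvPolynomial.eval_C, MvPolynomial.eval_map] at h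
    have h' : ∑ x ∈ q.support, (MvPolynomial.eval s (q x)) • Module.Free.chooseBasis k R x = 0 := by
      rw [← h]
      refine Finset.sum_congr rfl fun x _ => ?_
      rw [Algebra.smul_def, mul_comm, ← MvPolynomial.eval₂_id, MvPolynomial.hom_eval₂]
      rfl
    by_cases hi : i ∈ q.support
    · exact linearIndependent_iff'.mp (Module.Free.chooseBasis k R).linearIndependent _ _ h' i hi
    · simp [Finsupp.notMem_support_iff.mp hi]
  simp only [Finsupp.sum, map_sum, map_mul, MvPolynomial.eval_C, MvPolynomial.eval_map]
  refine Finset.sum_eq_zero fun i _ => ?_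
  have := hy (q i) (key i)
  rw [MvPolynomial.aeval_def] at this
  rw [this, mul_zero]

lemma scalarCoords_mul_mem {S : Subgroup (LinearMap.GeneralLinearGroup k V)} {g h : GLPoints k V R}
    (hg : ∀ p, (∀ s ∈ S, MvPolynomial.eval (ptCoords s) p = 0) →
      MvPolynomial.aeval (scalarCoords g) p = 0)
    (hh : ∀ p, (∀ s ∈ S, MvPolynomial.eval (ptCoords s) p = 0) →
      MvPolynomial.aeval (scalarCoords h) p = 0)
    (p : MvPolynomial _ k) (hp : ∀ s ∈ S, MvPolynomial.eval (ptCoords s) p = 0) :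
    MvPolynomial.aeval (scalarCoords (g * h)) p = 0 := by
  have conv : ∀ x : GLPoints k V R,
      (∀ p, (∀ s ∈ S, MvPolynomial.eval (ptCoords s) p = 0) →
        MvPolynomial.aeval (scalarCoords x) p = 0) →
      ∀ Q : MvPolynomial _ R, (∀ s ∈ S,
        MvPolynomial.eval (fun i => algebraMap k R (ptCoords s i)) Q = 0) →
        MvPolynomial.eval (scalarCoords x) Q = 0 := by
    intro x hx Q hQ
    refine eval_eq_zero_of_descent (S := ptCoords '' (S : Set _)) ?_ Q ?_
    · intro p hp
      exact hx p fun s hs => hp _ ⟨s, hs, rfl⟩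
    · rintro _ ⟨s, hs, rfl⟩
      exact hQ s hs
  have e1 : MvPolynomial.aeval (scalarCoords (g * h)) p = MvPolynomial.eval (scalarCoords g)
      (MvPolynomial.aeval (mulRightPoly (scalarCoords h)) p) := by
    rw [scalarCoords, coords_mul_right, MvPolynomial.aeval_def, MvPolynomial.aeval_def,
      MvPolynomial.hom_eval₂]
    congr 1
    ext x
    rw [RingHom.comp_apply, IsScalarTower.algebraMap_apply k R (MvPolynomial _ R),
      MvPolynomial.algebraMap_eq, MvPolynomial.eval_C]
  rw [e1]
  refine conv g hg _ fun s hs => ?_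
  have e2 : MvPolynomial.eval (fun i => algebraMap k R (ptCoords s i))
      (MvPolynomial.aeval (mulRightPoly (scalarCoords h)) p) =
      MvPolynomial.aeval (scalarCoords h) (MvPolynomial.aeval (mulLeftPoly (ptCoords s)) p) := by
    rw [MvPolynomial.aeval_def, MvPolynomial.aeval_def (mulLeftPoly _), MvPolynomial.hom_eval₂,
      ← AlgHom.coe_toRingHom, MvPolynomial.hom_eval₂]
    congr 1
    · ext x
      rw [RingHom.comp_apply, IsScalarTower.algebraMap_apply k R (MvPolynomial _ R),
        MvPolynomial.algebraMap_eq, MvPolynomial.eval_C]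
      simp [MvPolynomial.algebraMap_eq]
    · funext x
      rcases x with ⟨i, j⟩ | ⟨i, j⟩ <;> simp [mulRightPoly, mulLeftPoly]
  rw [e2]
  refine hh _ fun t ht => ?_
  have e3 : MvPolynomial.eval (ptCoords t) (MvPolynomial.aeval (mulLeftPoly (ptCoords s)) p) =
      MvPolynomial.eval (ptCoords (s * t)) p := by
    rw [ptCoords, ptCoords, ptCoords, coords_mul_left, MvPolynomial.aeval_def,
      MvPolynomial.hom_eval₂, ← MvPolynomial.eval₂_id]
    congr 1
    ext x
    simp [MvPolynomial.algebraMap_eq]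
  rw [e3]
  exact hp _ (S.mul_mem hs ht)

lemma scalarCoords_one (p : MvPolynomial _ k) :
    MvPolynomial.aeval (scalarCoords (1 : GLPoints k V R)) p =
      algebraMap k R (MvPolynomial.eval (ptCoords (1 : LinearMap.GeneralLinearGroup k V)) p) := by
  rw [MvPolynomial.aeval_def, ← MvPolynomial.eval₂_id, MvPolynomial.hom_eval₂]
  congr 1
  funext x
  classical
  rcases x with ⟨i, j⟩ | ⟨i, j⟩ <;>
    simp [scalarCoords, ptCoords, coords, Finsupp.single_apply, apply_ite (algebraMap k R)]

variable (R) in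
/-- The `R`-points of the Zariski closure in `GL_V` (a closed subgroup scheme over `k`) of a group
`S` of `k`-points: the points at which every regular function on `GL_V`, with coefficients in `k`,
that vanishes on `S` is zero. -/
def zariskiClosure (S : Subgroup (LinearMap.GeneralLinearGroup k V)) :
    Subgroup (GLPoints k V R) where
  carrier := {g | ∀ p, (∀ s ∈ S, MvPolynomial.eval (ptCoords s) p = 0) →
    MvPolynomial.aeval (scalarCoords g) p = 0}
  mul_mem' hg hh := scalarCoords_mul_mem hg hh
  one_mem' p hp := by rw [scalarCoords_one, hp 1 S.one_mem, map_zero]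
  inv_mem' := by
    intro g hg p hp
    have := hg (MvPolynomial.rename Sum.swap p) fun s hs => by
      rw [MvPolynomial.eval_rename, ptCoords, ← coords_inv]
      exact hp _ (S.inv_mem hs)
    rwa [MvPolynomial.aeval_rename, scalarCoords, ← coords_inv] at this

/-! ### Similitudes and isometries of a bilinear form -/

variable (R) in
/-- `GIso_{(V, ψ)}(R)`: the elements of `GL_V(R)` that multiply `ψ` by a unit `c = χ(g)` of `R`. -/
def GIso (ψ : LinearMap.BilinForm k V) : Subgroup (GLPoints k V R) where
  carrier := {g | ∃ c : Rˣ, ∀ v w,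
    ψ.baseChange R (g.val v) (g.val w) = (c : R) * ψ.baseChange R v w}
  mul_mem' := by
    rintro g h ⟨c, hc⟩ ⟨d, hd⟩
    refine ⟨c * d, fun v w => ?_⟩
    rw [Units.val_mul, Units.val_mul, Module.End.mul_apply, Module.End.mul_apply, hc, hd, mul_assoc]
  one_mem' := ⟨1, fun v w => by simp⟩
  inv_mem' := by
    rintro g ⟨c, hc⟩
    refine ⟨c⁻¹, fun v w => ?_⟩
    have h := hc (g⁻¹.val v) (g⁻¹.val w)
    simp only [← Module.End.mul_apply, ← Units.val_mul, mul_inv_cancel, Units.val_one,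
      Module.End.one_apply] at h
    rw [h, ← mul_assoc, Units.inv_mul, one_mul]

variable (R) in
/-- `Iso_{(V, ψ)}(R)`: the elements of `GL_V(R)` that preserve `ψ`. -/
def Iso (ψ : LinearMap.BilinForm k V) : Subgroup (GLPoints k V R) where
  carrier := {g | ∀ v w, ψ.baseChange R (g.val v) (g.val w) = ψ.baseChange R v w}
  mul_mem' := by
    intro g h hc hd v w
    rw [Units.val_mul, Module.End.mul_apply, Module.End.mul_apply, hc, hd]
  one_mem' := fun v w => by simp
  inv_mem' := by
    intro g hc v w
    have h := hc (g⁻¹.val v) (g⁻¹.val w)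
    simp only [← Module.End.mul_apply, ← Units.val_mul, mul_inv_cancel, Units.val_one,
      Module.End.one_apply] at h
    exact h.symm

end Closure

/-! ### The Zariski topology and identity components -/

section Topology

variable (k : Type*) [Field k] (V : Type*) [AddCommGroup V] [Module k V] [FiniteDimensional k V]
variable (Ω : Type*) [Field Ω] [Algebra k Ω]

/-- The Zariski topology on `GL_V(Ω)`: its basic open sets are the loci where a regular function
with coefficients in `Ω` does not vanish. -/
abbrev zariskiTopology : TopologicalSpace (GLPoints k V Ω) :=
  TopologicalSpace.generateFrom
    (Set.range fun p : MvPolynomial _ Ω => {g | MvPolynomial.eval (scalarCoords g) p ≠ 0})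

variable {k V Ω}

/-- `G°(Ω)` for a closed subgroup `G` of `GL_V`, as a subset of `GL_V(Ω)`: the Zariski connected
component of the identity in `G(Ω)`. (`Ω` will be algebraically closed.) -/
def identityComponent (G : Subgroup (GLPoints k V Ω)) : Set (GLPoints k V Ω) :=
  @connectedComponentIn _ (zariskiTopology k V Ω) (G : Set (GLPoints k V Ω)) 1

end Topology

/-! ### The groups attached to an `ℓ`-adic representation -/

section Galois

variable {K : Type*} [Field K] {Kbar : Type*} [Field Kbar] [Algebra K Kbar]
variable {ℓ : ℕ} [Fact ℓ.Prime]
variable {V : Type*} [AddCommGroup V] [Module ℚ_[ℓ] V] [FiniteDimensional ℚ_[ℓ] V]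

variable (Kbar ℓ) in
/-- The value of the `ℓ`-adic cyclotomic character, as an element of `ℚ_ℓ`. -/
def cyclotomic (σ : Gal(Kbar/K)) : ℚ_[ℓ] :=
  ((cyclotomicCharacter Kbar ℓ σ.toRingEquiv : ℤ_[ℓ]ˣ) : ℤ_[ℓ])

/-- Continuity of a representation on a finite-dimensional `ℚ_ℓ`-vector space: all matrix
coefficients are continuous for the Krull topology and the `ℓ`-adic topology. -/
def IsContinuousRep (ρ : Gal(Kbar/K) →* LinearMap.GeneralLinearGroup ℚ_[ℓ] V) : Prop :=
  ∀ (v : V) (φ : Module.Dual ℚ_[ℓ] V), Continuous fun σ => φ ((ρ σ).val v)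

/-- `ψ : V × V → ℚ_ℓ(-n)` is Galois equivariant, where `σ` acts on `ℚ_ℓ(-n)` as multiplication by
the `(-n)`-th power of the cyclotomic character. -/
def IsEquivariantForm (ψ : LinearMap.BilinForm ℚ_[ℓ] V) (n : ℤ)
    (ρ : Gal(Kbar/K) →* LinearMap.GeneralLinearGroup ℚ_[ℓ] V) : Prop :=
  ∀ σ v w, ψ ((ρ σ).val v) ((ρ σ).val w) = cyclotomic Kbar ℓ σ ^ (-n) * ψ v w

variable (Ω : Type*) [CommRing Ω] [Algebra ℚ_[ℓ] Ω]

/-- The `Ω`-points of the Zariski closure `G^alg_{ℓ,L}` of `ρ(G_L)` in `GIso_{(V, ψ)}`, where `L` is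
an intermediate field of `Kbar / K` and `G_L` its absolute Galois group; `L = ⊥` gives
`G^alg_{ℓ,K}`. -/
def Galg (ψ : LinearMap.BilinForm ℚ_[ℓ] V)
    (ρ : Gal(Kbar/K) →* LinearMap.GeneralLinearGroup ℚ_[ℓ] V) (L : IntermediateField K Kbar) :
    Subgroup (GLPoints ℚ_[ℓ] V Ω) :=
  GIso Ω ψ ⊓ zariskiClosure Ω (L.fixingSubgroup.map ρ)

/-- The `Ω`-points of `G^alg_{ℓ,L,1} = G^alg_{ℓ,L} ∩ Iso_{(V, ψ)}`. -/
def Galg₁ (ψ : LinearMap.BilinForm ℚ_[ℓ] V)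
    (ρ : Gal(Kbar/K) →* LinearMap.GeneralLinearGroup ℚ_[ℓ] V) (L : IntermediateField K Kbar) :
    Subgroup (GLPoints ℚ_[ℓ] V Ω) :=
  Galg Ω ψ ρ L ⊓ Iso Ω ψ

end Galois

end

end SatoTate

/-! Write S = ρ(G_K), T = ρ(G_L), and Z for the Zariski closure of T. As L/K is finite Galois, T is
normal of finite index in S, so the closure of S is a finite union of translates of Z
(`exists_eq_mul_of_mem_zariskiClosure`). Hence Z has finite index in the closure of S and is
normalised by it. Both groups attached to L are the intersections of Z with those attached to K,
which gives normality, finiteness and the injectivity of i_{L/K}; and a closed subgroup of finite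
index contains the identity component (`identityComponent_inf_eq`).

Surjectivity says that every point of G_K becomes an isometry after correction by a point of Z, so
it suffices that Z realises every multiplier c ∈ Ω^× (`exists_mem_zariskiClosure_similitude`). On T
the multipliers are the values χ_c^{-n}; these are infinite in number because n ≠ 0 and the degrees
of the K(ζ_{ℓ^i}) are unbounded. For ψ ≠ 0 the multiplier is a polynomial function on Z, so by
Chevalley's theorem it misses only finitely many values of Ω; since Z is a group and c = x · (c/x),
it misses no nonzero value. -/

namespace SatoTate

/-! ### Values of a polynomial on an affine variety -/

/-- A polynomial function on an affine variety over an algebraically closed field that takes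
infinitely many values misses only finitely many. -/
theorem finite_compl_image_eval_zeroLocus {σ Ω : Type*} [Finite σ] [Field Ω] [IsAlgClosed Ω]
    (J : Ideal (MvPolynomial σ Ω)) (P : MvPolynomial σ Ω)
    (hinf : ((fun y => MvPolynomial.eval y P) '' MvPolynomial.zeroLocus Ω J).Infinite) :
    ((fun y => MvPolynomial.eval y P) '' MvPolynomial.zeroLocus Ω J)ᶜ.Finite := by
  let φ : Polynomial Ω →ₐ[Ω] MvPolynomial σ Ω ⧸ J :=
    (Ideal.Quotient.mkₐ Ω J).comp (Polynomial.aeval P)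
  have hφ (f : Polynomial Ω) : φ f = Ideal.Quotient.mk J (Polynomial.aeval P f) := rfl
  have heval (f : Polynomial Ω) (y : σ → Ω) :
      MvPolynomial.aeval y (Polynomial.aeval P f) = f.eval (MvPolynomial.eval y P) := by
    rw [← Polynomial.aeval_algHom_apply, Polynomial.aeval_def, Polynomial.eval,
      MvPolynomial.aeval_eq_eval]
    rfl
  -- A polynomial in the kernel of X ↦ P has every value of P as a root, and there are infinitely
  -- many.
  have hinj : Function.Injective φ := by
    rw [injective_iff_map_eq_zero]
    intro f hf
    rw [hφ, Ideal.Quotient.eq_zero_iff_mem] at hf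
    by_contra h0
    refine hinf ((f.rootSet_finite Ω).subset ?_)
    rintro _ ⟨y, hy, rfl⟩
    rw [Polynomial.mem_rootSet]
    refine ⟨h0, ?_⟩
    rw [Polynomial.coe_aeval_eq_eval, ← heval]
    exact hy _ hf
  have hfp : φ.toRingHom.FinitePresentation := by
    refine RingHom.FinitePresentation.of_finiteType.mp ?_
    refine RingHom.FiniteType.of_comp_finiteType (f := Polynomial.C) ?_
    have : φ.toRingHom.comp Polynomial.C = algebraMap Ω (MvPolynomial σ Ω ⧸ J) := by
      ext x
      exact φ.commutes x
    rw [this, RingHom.finiteType_algebraMap]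
    infer_instance
  obtain ⟨D, hD⟩ := PrimeSpectrum.exists_constructibleSetData_iff.mpr
    (PrimeSpectrum.isConstructible_range_comap hfp)
  have hbot : (⊥ : PrimeSpectrum (Polynomial Ω)) ∈ D.toSet := by
    rw [hD]
    -- Minimal primes lift along an injective ring map, so the generic point of the line is in the
    -- constructible range.
    obtain ⟨p, hp, hpe⟩ := Ideal.exists_comap_eq_of_mem_minimalPrimes_of_injective
      (f := φ.toRingHom) hinj ⊥ (by simp [IsDomain.minimalPrimes_eq_singleton_bot])
    exact ⟨⟨p, hp⟩, PrimeSpectrum.ext hpe⟩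
  rw [PrimeSpectrum.ConstructibleSetData.toSet, Set.mem_iUnion₂] at hbot
  obtain ⟨C, hC, hCg, hCf⟩ := hbot
  -- The locally closed piece through the generic point has no closed condition, so it is the whole
  -- open set where `C.f` is nonzero. Only roots of `C.f` can be missed.
  have hg (i) : C.g i = 0 := hCg ⟨i, rfl⟩
  have hf : C.f ≠ 0 := fun h => hCf (by simp [h])
  refine (C.f.rootSet_finite Ω).subset fun c hc => ?_
  rw [Polynomial.mem_rootSet]
  refine ⟨hf, ?_⟩
  rw [Polynomial.coe_aeval_eq_eval]
  by_contra hfc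
  refine hc ?_
  have hprime : (Ideal.span {Polynomial.X - Polynomial.C c}).IsPrime :=
    (Ideal.span_singleton_prime (Polynomial.X_sub_C_ne_zero c)).mpr (Polynomial.prime_X_sub_C c)
  have hmem : (⟨_, hprime⟩ : PrimeSpectrum (Polynomial Ω)) ∈ D.toSet := by
    rw [PrimeSpectrum.ConstructibleSetData.toSet, Set.mem_iUnion₂]
    refine ⟨C, hC, ?_, ?_⟩
    · rintro _ ⟨i, rfl⟩
      rw [hg]
      exact Ideal.zero_mem _
    · intro h
      have h' := h (Set.mem_singleton _)
      rw [SetLike.mem_coe, Ideal.mem_span_singleton, Polynomial.dvd_iff_isRoot] at h'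
      exact hfc h'
  rw [hD] at hmem
  obtain ⟨q, hq⟩ := hmem
  -- A prime over (X - c) need not be a closed point; the Nullstellensatz turns a maximal ideal
  -- above it into a point y, and P(y) = c persists.
  obtain ⟨m, hm, hqm⟩ := Ideal.exists_le_maximal _
    (Ideal.IsPrime.comap (Ideal.Quotient.mk J) (K := q.asIdeal)).ne_top
  obtain ⟨y, rfl⟩ := MvPolynomial.isMaximal_iff_eq_vanishingIdeal_singleton.mp hm
  refine ⟨y, fun p hp => ?_, ?_⟩
  · refine hqm ?_ y rfl
    rw [Ideal.mem_comap, Ideal.Quotient.eq_zero_iff_mem.mpr hp]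
    exact Ideal.zero_mem _
  · have h1 : Polynomial.X - Polynomial.C c ∈ (PrimeSpectrum.comap φ.toRingHom q).asIdeal := by
      rw [hq]
      exact Ideal.mem_span_singleton_self _
    have h2 := hqm (show Polynomial.aeval P (Polynomial.X - Polynomial.C c) ∈ _ from h1) y rfl
    rw [heval] at h2
    simpa [sub_eq_zero] using h2

end SatoTate

/-! ### Zariski closures and subgroups of finite index -/

namespace SatoTate

section Points

variable {k : Type*} [Field k] {V : Type*} [AddCommGroup V] [Module k V]
variable {R : Type*} [CommRing R] [Algebra k R]

variable (R) in
/-- The inclusion `GL_V(k) → GL_V(R)`. -/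
noncomputable def toGLPoints : LinearMap.GeneralLinearGroup k V →* GLPoints k V R :=
  Units.map (Module.End.baseChangeHom k R V : Module.End k V →* Module.End R (R ⊗[k] V))

@[simp]
lemma toGLPoints_tmul (s : LinearMap.GeneralLinearGroup k V) (r : R) (v : V) :
    (toGLPoints R s).val (r ⊗ₜ v) = r ⊗ₜ s.val v := rfl

variable [FiniteDimensional k V]

lemma scalarCoords_toGLPoints (s : LinearMap.GeneralLinearGroup k V) :
    scalarCoords (toGLPoints R s) = fun i => algebraMap k R (ptCoords s i) := by
  funext x
  rcases x with ⟨i, j⟩ | ⟨i, j⟩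
  · simp [scalarCoords, ptCoords, coords, Algebra.algebraMap_eq_smul_one]
  · rw [scalarCoords, coords, Sum.elim_inr, ← map_inv, Module.Basis.baseChange_apply,
      toGLPoints_tmul]
    simp [ptCoords, coords, Algebra.algebraMap_eq_smul_one]

lemma aeval_scalarCoords_toGLPoints (s : LinearMap.GeneralLinearGroup k V) (p : MvPolynomial _ k) :
    MvPolynomial.aeval (scalarCoords (toGLPoints R s)) p =
      algebraMap k R (MvPolynomial.eval (ptCoords s) p) := by
  rw [scalarCoords_toGLPoints]
  exact MvPolynomial.aeval_algebraMap_apply R (ptCoords s) p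

lemma eval_scalarCoords_mul_left (g h : GLPoints k V R) (p : MvPolynomial _ R) :
    MvPolynomial.eval (scalarCoords h)
      (MvPolynomial.bind₁ (mulLeftPoly (scalarCoords g)) p) =
      MvPolynomial.eval (scalarCoords (g * h)) p := by
  rw [scalarCoords, scalarCoords, scalarCoords, coords_mul_left, ← MvPolynomial.aeval_eq_eval,
    ← MvPolynomial.aeval_eq_eval, MvPolynomial.aeval_bind₁]

lemma eval_scalarCoords_mul_right (g h : GLPoints k V R) (p : MvPolynomial _ R) :
    MvPolynomial.eval (scalarCoords g)
      (MvPolynomial.bind₁ (mulRightPoly (scalarCoords h)) p) =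
      MvPolynomial.eval (scalarCoords (g * h)) p := by
  rw [scalarCoords, scalarCoords, scalarCoords, coords_mul_right, ← MvPolynomial.aeval_eq_eval,
    ← MvPolynomial.aeval_eq_eval, MvPolynomial.aeval_bind₁]

/-- Membership in the Zariski closure can be tested on polynomials with coefficients in `R`. -/
lemma mem_zariskiClosure_iff {S : Subgroup (LinearMap.GeneralLinearGroup k V)}
    {g : GLPoints k V R} :
    g ∈ zariskiClosure R S ↔ ∀ Q : MvPolynomial _ R,
      (∀ s ∈ S, MvPolynomial.eval (scalarCoords (toGLPoints R s)) Q = 0) →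
        MvPolynomial.eval (scalarCoords g) Q = 0 := by
  constructor
  · intro hg Q hQ
    refine eval_eq_zero_of_descent (S := ptCoords '' (S : Set _))
      (fun p hp => hg p fun s hs => hp _ ⟨s, hs, rfl⟩) Q ?_
    rintro _ ⟨s, hs, rfl⟩
    rw [← scalarCoords_toGLPoints]
    exact hQ s hs
  · intro h p hp
    have := h (MvPolynomial.map (algebraMap k R) p) fun s hs => by
      rw [MvPolynomial.eval_map, ← MvPolynomial.aeval_def, aeval_scalarCoords_toGLPoints, hp s hs,
        map_zero]
    rwa [MvPolynomial.eval_map, ← MvPolynomial.aeval_def] at this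

lemma toGLPoints_mem_zariskiClosure {S : Subgroup (LinearMap.GeneralLinearGroup k V)}
    {s : LinearMap.GeneralLinearGroup k V} (hs : s ∈ S) : toGLPoints R s ∈ zariskiClosure R S :=
  mem_zariskiClosure_iff.mpr fun _ hQ => hQ s hs

lemma zariskiClosure_mono {S T : Subgroup (LinearMap.GeneralLinearGroup k V)} (h : T ≤ S) :
    zariskiClosure R T ≤ zariskiClosure R S :=
  fun _ hg p hp => hg p fun s hs => hp s (h hs)

/-- The Zariski closure of a group is the union of finitely many translates of the Zariski closure
of a subgroup of finite index. -/
theorem exists_eq_mul_of_mem_zariskiClosure [IsDomain R]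
    {S T : Subgroup (LinearMap.GeneralLinearGroup k V)} [(T.subgroupOf S).FiniteIndex]
    {h : GLPoints k V R} (hh : h ∈ zariskiClosure R S) :
    ∃ q : S ⧸ T.subgroupOf S, (toGLPoints R (q.out : LinearMap.GeneralLinearGroup k V))⁻¹ * h ∈
      zariskiClosure R T := by
  have : Fintype (S ⧸ T.subgroupOf S) := Fintype.ofFinite _
  by_contra! hcon
  simp only [mem_zariskiClosure_iff, not_forall] at hcon
  -- If h lies in no translate, each coset q has a polynomial vanishing on T but not at q⁻¹h. The
  -- product of their translates vanishes on S, yet not at h, since R is a domain.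
  choose Q hQ hQh using hcon
  refine (Finset.prod_ne_zero_iff (s := Finset.univ)).mpr (fun q _ => hQh q) ?_
  simp only [← eval_scalarCoords_mul_left, ← map_prod]
  refine mem_zariskiClosure_iff.mp hh _ fun s hs => ?_
  rw [map_prod]
  let q : S ⧸ T.subgroupOf S := QuotientGroup.mk ⟨s, hs⟩
  refine Finset.prod_eq_zero (Finset.mem_univ q) ?_
  rw [eval_scalarCoords_mul_left, ← map_inv, ← map_mul]
  refine hQ q _ ?_
  have : q.out⁻¹ * ⟨s, hs⟩ ∈ T.subgroupOf S :=
    QuotientGroup.leftRel_apply.mp (Quotient.exact (QuotientGroup.out_eq' q))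
  exact this

/-- Conjugation is polynomial in the coordinates, so a polynomial vanishing on T pulls back to one
that vanishes on T. -/
theorem conj_toGLPoints_mem_zariskiClosure
    {T : Subgroup (LinearMap.GeneralLinearGroup k V)} {s : LinearMap.GeneralLinearGroup k V}
    (hs : ∀ t ∈ T, s * t * s⁻¹ ∈ T) {g : GLPoints k V R} (hg : g ∈ zariskiClosure R T) :
    toGLPoints R s * g * (toGLPoints R s)⁻¹ ∈ zariskiClosure R T := by
  rw [mem_zariskiClosure_iff] at hg ⊢
  intro Q hQ
  rw [← eval_scalarCoords_mul_right, ← eval_scalarCoords_mul_left]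
  refine hg _ fun t ht => ?_
  rw [eval_scalarCoords_mul_left, eval_scalarCoords_mul_right, ← map_inv, ← map_mul, ← map_mul]
  exact hQ _ (hs t ht)

/-- Write h = su with s a representative in S and u in the closure of T; then hgh⁻¹ = s(ugu⁻¹)s⁻¹,
and only conjugation by the k-point s remains. -/
theorem conj_mem_zariskiClosure [IsDomain R]
    {S T : Subgroup (LinearMap.GeneralLinearGroup k V)} [(T.subgroupOf S).FiniteIndex]
    (hST : ∀ s ∈ S, ∀ t ∈ T, s * t * s⁻¹ ∈ T) {h g : GLPoints k V R}
    (hh : h ∈ zariskiClosure R S) (hg : g ∈ zariskiClosure R T) :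
    h * g * h⁻¹ ∈ zariskiClosure R T := by
  obtain ⟨q, hq⟩ := exists_eq_mul_of_mem_zariskiClosure (T := T) hh
  have := conj_toGLPoints_mem_zariskiClosure (hST _ q.out.2)
    (mul_mem (mul_mem hq hg) (inv_mem hq))
  convert this using 1
  group

/-- The cosets of T in S already represent all cosets of the closures. -/
theorem relIndex_zariskiClosure_ne_zero [IsDomain R]
    {S T : Subgroup (LinearMap.GeneralLinearGroup k V)} [(T.subgroupOf S).FiniteIndex] :
    (zariskiClosure R T).relIndex (zariskiClosure R S) ≠ 0 := by
  have : Finite (zariskiClosure R S ⧸ (zariskiClosure R T).subgroupOf (zariskiClosure R S)) := by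
    refine Finite.of_surjective (α := S ⧸ T.subgroupOf S) (fun q => QuotientGroup.mk
      ⟨_, toGLPoints_mem_zariskiClosure (R := R) q.out.2⟩) fun x => ?_
    obtain ⟨⟨h, hh⟩, rfl⟩ := QuotientGroup.mk_surjective x
    obtain ⟨q, hq⟩ := exists_eq_mul_of_mem_zariskiClosure (T := T) hh
    exact ⟨q, QuotientGroup.eq.mpr hq⟩
  exact Subgroup.index_ne_zero_of_finite

end Points

/-! ### Identity components -/

section Topology

open scoped Topology

variable {k : Type*} [Field k] {V : Type*} [AddCommGroup V] [Module k V] [FiniteDimensional k V]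
variable {Ω : Type*} [Field Ω] [Algebra k Ω]

lemma isClosed_setOf_eval_eq_zero (p : MvPolynomial _ Ω) :
    IsClosed[zariskiTopology k V Ω] {g | MvPolynomial.eval (scalarCoords g) p = 0} := by
  let _ := zariskiTopology k V Ω
  rw [← isOpen_compl_iff]
  exact TopologicalSpace.isOpen_generateFrom_of_mem ⟨p, rfl⟩

/-- The topology uses coefficients in Ω while the closure is defined over k;
`mem_zariskiClosure_iff` reconciles the two. -/
lemma isClosed_zariskiClosure (S : Subgroup (LinearMap.GeneralLinearGroup k V)) :
    IsClosed[zariskiTopology k V Ω] (zariskiClosure Ω S : Set (GLPoints k V Ω)) := by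
  let _ := zariskiTopology k V Ω
  have : (zariskiClosure Ω S : Set (GLPoints k V Ω)) = ⋂ (Q : MvPolynomial _ Ω)
      (_ : ∀ s ∈ S, MvPolynomial.eval (scalarCoords (toGLPoints Ω s)) Q = 0),
        {g | MvPolynomial.eval (scalarCoords g) Q = 0} := by
    ext g
    simp only [SetLike.mem_coe, mem_zariskiClosure_iff, Set.mem_iInter, Set.mem_ofPred_eq]
  rw [this]
  exact isClosed_iInter fun Q => isClosed_iInter fun _ => isClosed_setOf_eval_eq_zero Q

lemma continuous_mul_left_zariskiTopology (g : GLPoints k V Ω) :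
    @Continuous _ _ (zariskiTopology k V Ω) (zariskiTopology k V Ω) (g * ·) := by
  let _ := zariskiTopology k V Ω
  refine continuous_generateFrom_iff.mpr ?_
  rintro _ ⟨p, rfl⟩
  refine TopologicalSpace.isOpen_generateFrom_of_mem
    ⟨MvPolynomial.bind₁ (mulLeftPoly (scalarCoords g)) p, ?_⟩
  simp only [eval_scalarCoords_mul_left]
  rfl

/-- Intersecting with a closed subgroup does not change the identity component, if the index is
finite. -/
theorem identityComponent_inf_eq {Z G : Subgroup (GLPoints k V Ω)}
    (hZ : IsClosed[zariskiTopology k V Ω] (Z : Set (GLPoints k V Ω))) (hfin : Z.relIndex G ≠ 0) :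
    identityComponent (Z ⊓ G) = identityComponent G := by
  let _ := zariskiTopology k V Ω
  have : (Z.subgroupOf G).FiniteIndex := ⟨hfin⟩
  refine (connectedComponentIn_mono 1 (show ((Z ⊓ G : Subgroup (GLPoints k V Ω)) :
    Set (GLPoints k V Ω)) ⊆ G from Set.inter_subset_right)).antisymm ?_
  have hG := connectedComponentIn_subset (G : Set (GLPoints k V Ω)) 1
  have h1 := mem_connectedComponentIn (F := (G : Set (GLPoints k V Ω))) G.one_mem
  have hC : IsPreconnected (connectedComponentIn (G : Set (GLPoints k V Ω)) 1) :=
    isPreconnected_connectedComponentIn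
  refine hC.subset_connectedComponentIn h1 fun g hg => ⟨?_, hG hg⟩
  -- The union of the finitely many nontrivial translates of Z by representatives in G: closed,
  -- disjoint from Z, and covering G together with Z.
  let W : Set (GLPoints k V Ω) := ⋃ q : {q : G ⧸ Z.subgroupOf G // q ≠ QuotientGroup.mk 1},
    ((q.1.out : GLPoints k V Ω)⁻¹ * ·) ⁻¹' Z
  have hW : IsClosed W := isClosed_iUnion_of_finite fun q =>
    hZ.preimage (continuous_mul_left_zariskiTopology _)
  have hdisj (x) (hxZ : x ∈ Z) (hxW : x ∈ W) : False := by
    obtain ⟨⟨q, hq⟩, hx⟩ := Set.mem_iUnion.mp hxW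
    refine hq ?_
    rw [← QuotientGroup.out_eq' q]
    refine QuotientGroup.eq.mpr ?_
    rw [Subgroup.mem_subgroupOf]
    simpa using mul_mem (show _ ∈ Z from hx) (inv_mem hxZ)
  have hcover : connectedComponentIn (G : Set (GLPoints k V Ω)) 1 ⊆ Z ∪ W := by
    intro x hx
    let q : G ⧸ Z.subgroupOf G := QuotientGroup.mk ⟨x, hG hx⟩
    by_cases hq : q = QuotientGroup.mk 1
    · left
      have := QuotientGroup.eq.mp hq.symm
      simpa [Subgroup.mem_subgroupOf] using this
    · right
      have h : q.out⁻¹ * ⟨x, hG hx⟩ ∈ Z.subgroupOf G :=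
        QuotientGroup.leftRel_apply.mp (Quotient.exact (QuotientGroup.out_eq' q))
      exact Set.mem_iUnion.mpr ⟨⟨q, hq⟩, h⟩
  rcases isPreconnected_iff_subset_of_disjoint_closed.mp hC _ _ hZ hW hcover
    (Set.eq_empty_of_forall_notMem fun x hx => hdisj x hx.2.1 hx.2.2) with h | h
  · exact h hg
  · exact (hdisj 1 Z.one_mem (h h1)).elim

end Topology

/-! ### Multipliers of points of the Zariski closure -/

section Multiplier

variable {k : Type*} [Field k] {V : Type*} [AddCommGroup V] [Module k V] [FiniteDimensional k V]
variable {Ω : Type*} [Field Ω] [Algebra k Ω]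

/-- The zero locus of the ideal of a group of `k`-points consists of points of its Zariski
closure. -/
theorem exists_scalarCoords_eq {S : Subgroup (LinearMap.GeneralLinearGroup k V)} {y : _ → Ω}
    (hy : y ∈ MvPolynomial.zeroLocus Ω (MvPolynomial.vanishingIdeal Ω
      ((fun s => scalarCoords (toGLPoints Ω s)) '' (S : Set (LinearMap.GeneralLinearGroup k V))))) :
    ∃ g ∈ zariskiClosure Ω S, scalarCoords g = y := by
  have hy' (Q : MvPolynomial _ Ω)
      (hQ : ∀ s ∈ S, MvPolynomial.eval (scalarCoords (toGLPoints Ω s)) Q = 0) :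
      MvPolynomial.eval y Q = 0 := by
    refine hy Q ?_
    rintro _ ⟨s, hs, rfl⟩
    exact hQ s hs
  obtain ⟨B, hB⟩ : ∃ B, B = (Module.finBasis k V).baseChange Ω := ⟨_, rfl⟩
  let X : Matrix _ _ Ω := fun i j => y (Sum.inl (i, j))
  let Y : Matrix _ _ Ω := fun i j => y (Sum.inr (i, j))
  -- The entries of XY - 1 are polynomials vanishing on S, hence also at y; this is what makes y the
  -- coordinates of an invertible map.
  have hXY : X * Y = 1 := by
    ext i j
    have := hy' (∑ l, MvPolynomial.X (Sum.inl (i, l)) * MvPolynomial.X (Sum.inr (l, j)) -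
      MvPolynomial.C ((1 : Matrix _ _ Ω) i j)) fun s _ => by
        have := repr_mul ((Module.finBasis k V).baseChange Ω) (toGLPoints Ω s) (toGLPoints Ω s)⁻¹ i j
        simp only [map_sub, map_sum, map_mul, MvPolynomial.eval_X, MvPolynomial.eval_C, sub_eq_zero]
        refine this.symm.trans ?_
        simp [Matrix.one_apply, Finsupp.single_apply, eq_comm]
    simpa [sub_eq_zero, Matrix.mul_apply] using this
  have hYX : Y * X = 1 := mul_eq_one_comm.mp hXY
  let g : GLPoints k V Ω := ⟨Matrix.toLin B B X, Matrix.toLin B B Y,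
    by rw [Module.End.mul_eq_comp, ← Matrix.toLin_mul, hXY, Matrix.toLin_one]; rfl,
    by rw [Module.End.mul_eq_comp, ← Matrix.toLin_mul, hYX, Matrix.toLin_one]; rfl⟩
  have key (M : Matrix _ _ Ω) (i j) : B.repr (Matrix.toLin B B M (B j)) i = M i j := by
    rw [← LinearMap.toMatrix_apply, LinearMap.toMatrix_toLin]
  have hg : scalarCoords g = y := by
    funext x
    rcases x with ⟨i, j⟩ | ⟨i, j⟩
    · rw [scalarCoords, coords, Sum.elim_inl, ← hB]
      exact key X i j
    · rw [scalarCoords, coords, Sum.elim_inr, ← hB]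
      exact key Y i j
  exact ⟨g, mem_zariskiClosure_iff.mpr fun Q hQ => hg ▸ hy' Q hQ, hg⟩

/-- The value `ψ(g b_i, g b_j)` on basis vectors, as a polynomial in the coordinates of `g`. -/
noncomputable def formPoly (Ω : Type*) [Field Ω] [Algebra k Ω] (ψ : LinearMap.BilinForm k V)
    (i j : Fin (Module.finrank k V)) :
    MvPolynomial ((Fin (Module.finrank k V) × Fin (Module.finrank k V)) ⊕
      (Fin (Module.finrank k V) × Fin (Module.finrank k V))) Ω :=
  ∑ p, ∑ q, MvPolynomial.X (Sum.inl (p, i)) * (MvPolynomial.X (Sum.inl (q, j)) *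
    MvPolynomial.C (algebraMap k Ω (ψ (Module.finBasis k V p) (Module.finBasis k V q))))

lemma eval_formPoly (ψ : LinearMap.BilinForm k V) (g : GLPoints k V Ω)
    (i j : Fin (Module.finrank k V)) :
    MvPolynomial.eval (scalarCoords g) (formPoly Ω ψ i j) =
      ψ.baseChange Ω (g.val ((Module.finBasis k V).baseChange Ω i))
        (g.val ((Module.finBasis k V).baseChange Ω j)) := by
  set B := (Module.finBasis k V).baseChange Ω with hB
  rw [← LinearMap.sum_repr_mul_repr_mul B B, Finsupp.sum_fintype _ _ (by simp)]
  simp only [formPoly, map_sum, map_mul, MvPolynomial.eval_X, MvPolynomial.eval_C]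
  refine Finset.sum_congr rfl fun p _ => ?_
  rw [Finsupp.sum_fintype _ _ (by simp)]
  refine Finset.sum_congr rfl fun q _ => ?_
  simp [scalarCoords, coords, hB, Algebra.algebraMap_eq_smul_one]

lemma eval_formPoly_toGLPoints {ψ : LinearMap.BilinForm k V}
    {s : LinearMap.GeneralLinearGroup k V} {d : k}
    (h : ∀ v w, ψ (s.val v) (s.val w) = d * ψ v w) (i j : Fin (Module.finrank k V)) :
    MvPolynomial.eval (scalarCoords (toGLPoints Ω s)) (formPoly Ω ψ i j) =
      algebraMap k Ω d *
        algebraMap k Ω (ψ (Module.finBasis k V i) (Module.finBasis k V j)) := by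
  rw [eval_formPoly]
  simp only [Module.Basis.baseChange_apply, toGLPoints_tmul]
  simp [h, Algebra.algebraMap_eq_smul_one, mul_smul, smul_comm d]

/-- If a group of similitudes has infinitely many multipliers, then every nonzero scalar is the
multiplier of a point of its Zariski closure. -/
theorem exists_mem_zariskiClosure_similitude [IsAlgClosed Ω] (ψ : LinearMap.BilinForm k V)
    (S : Subgroup (LinearMap.GeneralLinearGroup k V))
    (hS : ∀ s ∈ S, ∃ d : k, ∀ v w, ψ (s.val v) (s.val w) = d * ψ v w)
    (hinf : {d : k | ∃ s ∈ S, ∀ v w, ψ (s.val v) (s.val w) = d * ψ v w}.Infinite)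
    {c : Ω} (hc : c ≠ 0) :
    ∃ g ∈ zariskiClosure Ω S, ∀ v w,
      ψ.baseChange Ω (g.val v) (g.val w) = c * ψ.baseChange Ω v w := by
  let b := Module.finBasis k V
  by_cases hψ : ∀ i j, ψ (b i) (b j) = 0
  · have : ψ = 0 := LinearMap.BilinForm.ext_basis b fun i j => hψ i j
    subst this
    exact ⟨1, one_mem _, fun v w => by simp⟩
  push Not at hψ
  obtain ⟨a, e, hae⟩ := hψ
  have hae' : algebraMap k Ω (ψ (b a) (b e)) ≠ 0 := by simpa using hae
  -- The multiplier as a polynomial, read off from one pair of basis vectors with ψ(b_a, b_e) ≠ 0.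
  let P := formPoly Ω ψ a e * MvPolynomial.C (algebraMap k Ω (ψ (b a) (b e)))⁻¹
  have hPs {s : LinearMap.GeneralLinearGroup k V} {d : k}
      (h : ∀ v w, ψ (s.val v) (s.val w) = d * ψ v w) :
      MvPolynomial.eval (scalarCoords (toGLPoints Ω s)) P = algebraMap k Ω d := by
    rw [map_mul, eval_formPoly_toGLPoints h, MvPolynomial.eval_C]
    exact mul_inv_cancel_right₀ hae' _
  have hP {g : GLPoints k V Ω} (hg : g ∈ zariskiClosure Ω S) (v w) :
      ψ.baseChange Ω (g.val v) (g.val w) =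
        MvPolynomial.eval (scalarCoords g) P * ψ.baseChange Ω v w := by
    -- That P is the multiplier for every other pair is a polynomial identity on S, so it extends to
    -- the closure.
    have hb (i j) := mem_zariskiClosure_iff.mp hg
      (formPoly Ω ψ i j - P * MvPolynomial.C (algebraMap k Ω (ψ (b i) (b j)))) fun s hs => by
        obtain ⟨d, hd⟩ := hS s hs
        rw [map_sub, map_mul, hPs hd, eval_formPoly_toGLPoints hd, MvPolynomial.eval_C,
          sub_self]
    have := LinearMap.BilinForm.ext_basis (b.baseChange Ω)
      (B := (ψ.baseChange Ω).compl₁₂ g.val g.val)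
      (F₂ := MvPolynomial.eval (scalarCoords g) P • ψ.baseChange Ω) fun i j => by
        have := hb i j
        rw [map_sub, eval_formPoly, sub_eq_zero, map_mul, MvPolynomial.eval_C] at this
        simpa [b, Algebra.algebraMap_eq_smul_one] using this
    exact LinearMap.congr_fun₂ this v w
  set J := MvPolynomial.vanishingIdeal Ω
    ((fun s => scalarCoords (toGLPoints Ω s)) '' (S : Set (LinearMap.GeneralLinearGroup k V)))
  set I := (fun y => MvPolynomial.eval y P) '' MvPolynomial.zeroLocus Ω J
  have hI : Iᶜ.Finite := by
    refine finite_compl_image_eval_zeroLocus J P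
      ((hinf.image (algebraMap k Ω).injective.injOn).mono ?_)
    rintro _ ⟨d, ⟨s, hs, hd⟩, rfl⟩
    exact ⟨_, MvPolynomial.zeroLocus_vanishingIdeal_le _ ⟨s, hs, rfl⟩, hPs hd⟩
  -- The map x ↦ c/x is injective even at 0, where it takes the value 0, because c ≠ 0.
  have hI' : ((fun x => c / x) ⁻¹' Iᶜ).Finite := hI.preimage fun x _ y _ h => by
    rcases eq_or_ne x 0 with rfl | hx <;> rcases eq_or_ne y 0 with rfl | hy <;>
      simp_all [div_eq_mul_inv]
  have : Infinite Ω := IsAlgClosed.instInfinite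
  obtain ⟨x, hx⟩ := ((hI.union hI').union (Set.finite_singleton 0)).infinite_compl.nonempty
  simp only [Set.mem_compl_iff, Set.mem_union, Set.mem_preimage, Set.mem_singleton_iff, not_or,
    not_not] at hx
  obtain ⟨⟨⟨y, hy, hyx⟩, z, hz, hzx⟩, hx0⟩ := hx
  obtain ⟨g, hg, rfl⟩ := exists_scalarCoords_eq hy
  obtain ⟨h, hh, rfl⟩ := exists_scalarCoords_eq hz
  refine ⟨g * h, mul_mem hg hh, fun v w => ?_⟩
  dsimp only at hyx hzx
  rw [Units.val_mul, Module.End.mul_apply, Module.End.mul_apply, hP hg, hP hh, hyx, hzx,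
    ← mul_assoc, mul_div_cancel₀ _ hx0]

end Multiplier

end SatoTate

/-! ### Infinite image of the cyclotomic character -/

namespace SatoTate

/-- A finite image would give a kernel N of finite index in the Galois group of K, fixing every
ℓ^i-th root of unity. Then φ(ℓ^i) = [ℚ(ζ) : ℚ] ≤ [K : ℚ] · [G_K : N] for all i, which is absurd. -/
theorem infinite_range_cyclotomicCharacter {K Kbar : Type*} [Field K] [NumberField K] [Field Kbar]
    [Algebra K Kbar] [IsAlgClosure K Kbar] (ℓ : ℕ) [Fact ℓ.Prime] (H : Subgroup Gal(Kbar/K))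
    [H.FiniteIndex] :
    (Set.range fun σ : H => cyclotomicCharacter Kbar ℓ σ.1.toRingEquiv).Infinite := by
  intro hfin
  have : CharZero Kbar := charZero_of_injective_algebraMap (algebraMap K Kbar).injective
  have : IsAlgClosed Kbar := IsAlgClosure.isAlgClosed K
  have : Algebra.IsAlgebraic K Kbar := IsAlgClosure.isAlgebraic
  have : IsGalois K Kbar := {}
  have hℓ : ℓ.Prime := Fact.out
  have (i : ℕ) : NeZero (ℓ ^ i) := ⟨(pow_pos hℓ.pos i).ne'⟩
  have (i : ℕ) : NeZero ((ℓ ^ i : ℕ) : Kbar) := ⟨by exact_mod_cast (pow_pos hℓ.pos i).ne'⟩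
  let χ : H →* ℤ_[ℓ]ˣ := (cyclotomicCharacter Kbar ℓ).comp
    ((MulSemiringAction.toRingAut Gal(Kbar/K) Kbar).comp H.subtype)
  have : Finite χ.range := hfin
  have hker : χ.ker.FiniteIndex := Subgroup.finiteIndex_ker χ
  let N := χ.ker.map H.subtype
  have hN : N.index ≠ 0 := by
    rw [Subgroup.index_map_subtype]
    exact mul_ne_zero hker.index_ne_zero Subgroup.FiniteIndex.index_ne_zero
  have hbound (i : ℕ) : (ℓ ^ i).totient ≤ Module.finrank ℚ K * N.index := by
    obtain ⟨ζ, hζ⟩ := HasEnoughRootsOfUnity.exists_primitiveRoot Kbar (ℓ ^ i)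
    have hNle : N ≤ (IntermediateField.adjoin K {ζ}).fixingSubgroup := by
      rw [← IntermediateField.le_iff_le, IntermediateField.adjoin_simple_le_iff,
        IntermediateField.mem_fixedField_iff]
      rintro _ ⟨σ, hσ, rfl⟩
      have h1 := cyclotomicCharacter.spec ℓ (H.subtype σ).toRingEquiv ζ hζ.pow_eq_one
      have h2 := cyclotomicCharacter.spec ℓ (1 : Kbar ≃+* Kbar) ζ hζ.pow_eq_one
      rw [map_one, ← show cyclotomicCharacter Kbar ℓ (H.subtype σ).toRingEquiv = 1 from hσ,
        ← h1] at h2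
      exact h2.symm
    have hdim : Module.finrank K (IntermediateField.adjoin K {ζ}) ≤ N.index := by
      rw [IntermediateField.finrank_eq_fixingSubgroup_index]
      exact Nat.le_of_dvd (Nat.pos_of_ne_zero hN) (Subgroup.index_dvd_of_le hNle)
    have : FiniteDimensional K (IntermediateField.adjoin K {ζ}) :=
      IntermediateField.adjoin.finiteDimensional (Algebra.IsIntegral.isIntegral ζ)
    have : FiniteDimensional ℚ (IntermediateField.adjoin K {ζ}) := .trans ℚ K _
    calc (ℓ ^ i).totient = (minpoly ℚ ζ).natDegree := by
          rw [← Polynomial.cyclotomic_eq_minpoly_rat hζ (pow_pos hℓ.pos i),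
            Polynomial.natDegree_cyclotomic]
      _ = (minpoly ℚ (IntermediateField.AdjoinSimple.gen K ζ)).natDegree := by
          rw [← minpoly.algebraMap_eq (B := IntermediateField.adjoin K {ζ}) (B' := Kbar)
            (algebraMap (IntermediateField.adjoin K {ζ}) Kbar).injective, IntermediateField.AdjoinSimple.algebraMap_gen]
      _ ≤ Module.finrank ℚ (IntermediateField.adjoin K {ζ}) := minpoly.natDegree_le _
      _ = Module.finrank ℚ K * Module.finrank K (IntermediateField.adjoin K {ζ}) :=
          (Module.finrank_mul_finrank _ _ _).symm
      _ ≤ _ := Nat.mul_le_mul_left _ hdim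
  -- With D the bound and i = D + 1, φ(ℓ^i) = ℓ^D (ℓ - 1) ≥ ℓ^D > D.
  have h := hbound (Module.finrank ℚ K * N.index + 1)
  rw [Nat.totient_prime_pow_succ hℓ] at h
  have h1 := Nat.lt_pow_self (n := Module.finrank ℚ K * N.index) hℓ.one_lt
  have h2 := Nat.le_mul_of_pos_right (ℓ ^ (Module.finrank ℚ K * N.index))
    (Nat.sub_pos_of_lt hℓ.one_lt)
  omega

theorem infinite_image_cyclotomic_zpow {K Kbar : Type*} [Field K] [NumberField K] [Field Kbar]
    [Algebra K Kbar] [IsAlgClosure K Kbar] (ℓ : ℕ) [Fact ℓ.Prime] (H : Subgroup Gal(Kbar/K))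
    [H.FiniteIndex] {n : ℤ} (hn : n ≠ 0) :
    ((fun σ => cyclotomic Kbar ℓ σ ^ n) '' (H : Set Gal(Kbar/K))).Infinite := by
  intro hfin
  set F := (fun σ => cyclotomic Kbar ℓ σ ^ n) '' (H : Set Gal(Kbar/K))
  have hroots (c : ℚ_[ℓ]) : {x : ℚ_[ℓ] | x ^ n.natAbs = c}.Finite := by
    classical
    refine (Polynomial.nthRoots n.natAbs c).toFinset.finite_toSet.subset fun x hx => ?_
    simpa [Polynomial.mem_nthRoots (Int.natAbs_pos.mpr hn)] using hx
  have hfin' : {x : ℚ_[ℓ] | x ^ n ∈ F}.Finite := by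
    -- The exponent n may be negative: x^|n| lies in F or in the set of inverses of F, and each
    -- value has finitely many |n|-th roots.
    refine ((hfin.union (hfin.image (·⁻¹))).biUnion fun c _ => hroots c).subset fun x hx => ?_
    simp only [Set.mem_iUnion]
    refine ⟨x ^ n.natAbs, ?_, rfl⟩
    rcases Int.natAbs_eq n with h | h
    · left
      rw [Set.mem_ofPred_eq, h, zpow_natCast] at hx
      exact hx
    · right
      rw [Set.mem_ofPred_eq, h, zpow_neg, zpow_natCast] at hx
      exact ⟨_, hx, inv_inv _⟩
  refine infinite_range_cyclotomicCharacter (K := K) (Kbar := Kbar) ℓ H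
    (Set.Finite.of_finite_image (f := fun u : ℤ_[ℓ]ˣ => ((u : ℤ_[ℓ]) : ℚ_[ℓ])) (hfin'.subset ?_) ?_)
  · rintro _ ⟨_, ⟨σ, rfl⟩, rfl⟩
    exact ⟨σ.1, σ.2, rfl⟩
  · exact fun u _ v _ h => Units.ext (Subtype.ext h)

end SatoTate

/-! ### Comparing quotients by a common closed subgroup -/

namespace SatoTate

section Groups

variable {k : Type*} [Field k] {V : Type*} [AddCommGroup V] [Module k V]
variable {R : Type*} [CommRing R] [Algebra k R]

lemma Iso_le_GIso (ψ : LinearMap.BilinForm k V) : Iso R ψ ≤ GIso R ψ :=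
  fun g hg => ⟨1, fun v w => by rw [hg v w, Units.val_one, one_mul]⟩

lemma mul_inv_mem_Iso {ψ : LinearMap.BilinForm k V} {g h : GLPoints k V R} {c : R}
    (hg : ∀ v w, ψ.baseChange R (g.val v) (g.val w) = c * ψ.baseChange R v w)
    (hh : ∀ v w, ψ.baseChange R (h.val v) (h.val w) = c * ψ.baseChange R v w) :
    g * h⁻¹ ∈ Iso R ψ := by
  intro v w
  rw [Units.val_mul, Module.End.mul_apply, Module.End.mul_apply, hg, ← hh]
  simp only [← Module.End.mul_apply, ← Units.val_mul, mul_inv_cancel, Units.val_one,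
    Module.End.one_apply]

end Groups

section Quotient

variable {G : Type*} [Group G]

/-- If `A` meets every coset of `Z` in `B`, then `A / (Z ∩ A) ≃ B / (Z ∩ B)`. -/
theorem exists_quotient_mulEquiv {A B Z A' B' : Subgroup G} (hAB : A ≤ B) (hA' : A' = Z ⊓ A)
    (hB' : B' = Z ⊓ B) (hconj : ∀ g ∈ B, ∀ z ∈ Z, g * z * g⁻¹ ∈ Z)
    (hsurj : ∀ g ∈ B, ∃ z ∈ Z, z ∈ B ∧ g * z⁻¹ ∈ A) :
    ∃ (_ : (B'.subgroupOf B).Normal) (_ : (A'.subgroupOf A).Normal)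
      (i : (A ⧸ A'.subgroupOf A) ≃* (B ⧸ B'.subgroupOf B)),
      ∀ g : A, i (QuotientGroup.mk g) = QuotientGroup.mk (Subgroup.inclusion hAB g) := by
  subst hA' hB'
  have hB : ((Z ⊓ B).subgroupOf B).Normal := ⟨fun z hz g => by
    rw [Subgroup.mem_subgroupOf] at hz ⊢
    exact ⟨hconj _ g.2 _ hz.1, (g * z * g⁻¹).2⟩⟩
  have hA : ((Z ⊓ A).subgroupOf A).Normal := ⟨fun z hz g => by
    rw [Subgroup.mem_subgroupOf] at hz ⊢
    exact ⟨hconj _ (hAB g.2) _ hz.1, (g * z * g⁻¹).2⟩⟩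
  refine ⟨hB, hA, MulEquiv.ofBijective (QuotientGroup.map _
    ((Z ⊓ B).subgroupOf B) (Subgroup.inclusion hAB)
    fun z (hz : z.1 ∈ Z ⊓ A) => (show z.1 ∈ Z ⊓ B from ⟨hz.1, hAB z.2⟩)) ⟨?_, ?_⟩, fun g => rfl⟩
  · rw [injective_iff_map_eq_one]
    intro x hx
    obtain ⟨a, rfl⟩ := QuotientGroup.mk_surjective x
    have ha : Subgroup.inclusion hAB a ∈ (Z ⊓ B).subgroupOf B :=
      (QuotientGroup.eq_one_iff _).mp hx
    exact (QuotientGroup.eq_one_iff _).mpr ⟨ha.1, a.2⟩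
  · intro x
    obtain ⟨b, rfl⟩ := QuotientGroup.mk_surjective x
    obtain ⟨z, hz, hzB, hzA⟩ := hsurj b.1 b.2
    refine ⟨QuotientGroup.mk ⟨_, hzA⟩, QuotientGroup.eq.mpr ?_⟩
    have h : (b.1 * z⁻¹)⁻¹ * b.1 = z := by group
    rw [Subgroup.mem_subgroupOf]
    exact (congrArg (· ∈ Z ⊓ B) h).mpr ⟨hz, hzB⟩

end Quotient

section Galois

variable {K : Type*} [Field K] {Kbar : Type*} [Field Kbar] [Algebra K Kbar]
variable {ℓ : ℕ} [Fact ℓ.Prime]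
variable {V : Type*} [AddCommGroup V] [Module ℚ_[ℓ] V] [FiniteDimensional ℚ_[ℓ] V]
variable (Ω : Type*) [CommRing Ω] [Algebra ℚ_[ℓ] Ω]

/-- Together with its analogue for `Galg₁`, this puts both pairs of groups in the form "Z ∩ G inside
G" with one and the same Z, as the quotient and identity component arguments require. -/
lemma Galg_eq_inf_bot (ψ : LinearMap.BilinForm ℚ_[ℓ] V)
    (ρ : Gal(Kbar/K) →* LinearMap.GeneralLinearGroup ℚ_[ℓ] V) (L : IntermediateField K Kbar) :
    Galg Ω ψ ρ L = zariskiClosure Ω (L.fixingSubgroup.map ρ) ⊓ Galg Ω ψ ρ ⊥ := by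
  have h : zariskiClosure Ω (L.fixingSubgroup.map ρ) ≤ zariskiClosure Ω
      ((⊥ : IntermediateField K Kbar).fixingSubgroup.map ρ) :=
    zariskiClosure_mono (Subgroup.map_mono (IntermediateField.fixingSubgroup_antitone bot_le))
  rw [Galg, Galg, ← inf_assoc, inf_right_comm, inf_eq_left.mpr h, inf_comm]

lemma Galg₁_eq_inf_bot (ψ : LinearMap.BilinForm ℚ_[ℓ] V)
    (ρ : Gal(Kbar/K) →* LinearMap.GeneralLinearGroup ℚ_[ℓ] V) (L : IntermediateField K Kbar) :
    Galg₁ Ω ψ ρ L = zariskiClosure Ω (L.fixingSubgroup.map ρ) ⊓ Galg₁ Ω ψ ρ ⊥ := by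
  rw [Galg₁, Galg₁, Galg_eq_inf_bot, inf_assoc]

end Galois

end SatoTate

/-! ### The comparison theorem -/

theorem mainTheorem12
    {K : Type*} [Field K] [NumberField K]
    {Kbar : Type*} [Field Kbar] [Algebra K Kbar] [IsAlgClosure K Kbar]
    {ℓ : ℕ} [Fact ℓ.Prime]
    {V : Type*} [AddCommGroup V] [Module ℚ_[ℓ] V] [FiniteDimensional ℚ_[ℓ] V]
    (n : ℤ) (hn : n ≠ 0)
    (ψ : LinearMap.BilinForm ℚ_[ℓ] V) (hψ : ψ.Nondegenerate)
    (hψ_symm : ∀ v w, ψ w v = (-1) ^ n * ψ v w)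
    (ρ : Gal(Kbar/K) →* LinearMap.GeneralLinearGroup ℚ_[ℓ] V)
    (hρ : SatoTate.IsContinuousRep ρ) (hρψ : SatoTate.IsEquivariantForm ψ n ρ)
    (L : IntermediateField K Kbar) [FiniteDimensional K L] [IsGalois K L]
    (Ω : Type*) [Field Ω] [Algebra ℚ_[ℓ] Ω] [IsAlgClosed Ω] :
    (∃ (_ : ((SatoTate.Galg Ω ψ ρ L).subgroupOf (SatoTate.Galg Ω ψ ρ ⊥)).Normal)
       (_ : ((SatoTate.Galg₁ Ω ψ ρ L).subgroupOf (SatoTate.Galg₁ Ω ψ ρ ⊥)).Normal)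
       (i : (SatoTate.Galg₁ Ω ψ ρ ⊥ ⧸
              (SatoTate.Galg₁ Ω ψ ρ L).subgroupOf (SatoTate.Galg₁ Ω ψ ρ ⊥)) ≃*
            (SatoTate.Galg Ω ψ ρ ⊥ ⧸
              (SatoTate.Galg Ω ψ ρ L).subgroupOf (SatoTate.Galg Ω ψ ρ ⊥))),
        (∀ g : SatoTate.Galg₁ Ω ψ ρ ⊥,
          i (QuotientGroup.mk g) = QuotientGroup.mk (Subgroup.inclusion inf_le_left g)) ∧
        Finite (SatoTate.Galg₁ Ω ψ ρ ⊥ ⧸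
          (SatoTate.Galg₁ Ω ψ ρ L).subgroupOf (SatoTate.Galg₁ Ω ψ ρ ⊥)) ∧
        Finite (SatoTate.Galg Ω ψ ρ ⊥ ⧸
          (SatoTate.Galg Ω ψ ρ L).subgroupOf (SatoTate.Galg Ω ψ ρ ⊥))) ∧
    (SatoTate.Galg Ω ψ ρ L ≤ SatoTate.Galg Ω ψ ρ ⊥ ∧
      SatoTate.Galg₁ Ω ψ ρ L ≤ SatoTate.Galg₁ Ω ψ ρ ⊥) ∧
    SatoTate.identityComponent (SatoTate.Galg Ω ψ ρ L) =
      SatoTate.identityComponent (SatoTate.Galg Ω ψ ρ ⊥) ∧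
    SatoTate.identityComponent (SatoTate.Galg₁ Ω ψ ρ L) =
      SatoTate.identityComponent (SatoTate.Galg₁ Ω ψ ρ ⊥) := by
  have : Algebra.IsAlgebraic K Kbar := IsAlgClosure.isAlgebraic
  have : IsAlgClosed Kbar := IsAlgClosure.isAlgClosed K
  have : IsGalois K Kbar := {}
  have hfin : L.fixingSubgroup.FiniteIndex :=
    ⟨by rw [← IntermediateField.finrank_eq_fixingSubgroup_index]; exact Module.finrank_pos.ne'⟩
  set S := (⊥ : IntermediateField K Kbar).fixingSubgroup.map ρ with hS
  set T := L.fixingSubgroup.map ρ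
  have hTS : (T.subgroupOf S).FiniteIndex := by
    refine ⟨?_⟩
    change T.relIndex S ≠ 0
    -- ρ need not be injective: the index of the images is that of the subgroup generated by G_L and
    -- ker ρ.
    rw [hS, IntermediateField.fixingSubgroup_bot, Subgroup.relIndex_map_map, top_sup_eq,
      Subgroup.relIndex_top_right]
    exact (Subgroup.finiteIndex_of_le (H := L.fixingSubgroup) le_sup_left).index_ne_zero
  have hconj : ∀ s ∈ S, ∀ t ∈ T, s * t * s⁻¹ ∈ T := by
    rintro _ ⟨s, -, rfl⟩ _ ⟨t, ht, rfl⟩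
    exact ⟨s * t * s⁻¹, Subgroup.Normal.conj_mem inferInstance _ ht _, by simp⟩
  have hle : SatoTate.Galg Ω ψ ρ ⊥ ≤ SatoTate.zariskiClosure Ω S := inf_le_right
  have hle₁ : SatoTate.Galg₁ Ω ψ ρ ⊥ ≤ SatoTate.Galg Ω ψ ρ ⊥ := inf_le_left
  have hrel : (SatoTate.zariskiClosure Ω T).relIndex (SatoTate.Galg Ω ψ ρ ⊥) ≠ 0 :=
    mt (Subgroup.relIndex_eq_zero_of_le_right hle) SatoTate.relIndex_zariskiClosure_ne_zero
  have hrel₁ : (SatoTate.zariskiClosure Ω T).relIndex (SatoTate.Galg₁ Ω ψ ρ ⊥) ≠ 0 :=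
    mt (Subgroup.relIndex_eq_zero_of_le_right hle₁) hrel
  have hL := SatoTate.Galg_eq_inf_bot Ω ψ ρ L
  have hL₁ := SatoTate.Galg₁_eq_inf_bot Ω ψ ρ L
  have hmult {c : Ω} (hc : c ≠ 0) := SatoTate.exists_mem_zariskiClosure_similitude (Ω := Ω) ψ T
    (by
      rintro _ ⟨σ, -, rfl⟩
      exact ⟨_, hρψ σ⟩)
    ((SatoTate.infinite_image_cyclotomic_zpow (K := K) (Kbar := Kbar) ℓ L.fixingSubgroup
      (neg_ne_zero.mpr hn)).mono (by
        rintro _ ⟨σ, hσ, rfl⟩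
        exact ⟨_, ⟨σ, hσ, rfl⟩, hρψ σ⟩)) hc
  obtain ⟨hn, hn₁, i, hi⟩ := SatoTate.exists_quotient_mulEquiv hle₁ hL₁ hL
    (fun g hg z hz => SatoTate.conj_mem_zariskiClosure hconj (hle hg) hz) (by
      rintro g ⟨⟨c, hc⟩, (hg : g ∈ SatoTate.zariskiClosure Ω S)⟩
      -- Choosing z in Z with the same multiplier as g makes gz⁻¹ an isometry in the same coset as
      -- g.
      obtain ⟨z, hz, hzc⟩ := hmult c.ne_zero
      have hzK : z ∈ SatoTate.zariskiClosure Ω S := SatoTate.zariskiClosure_mono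
        (Subgroup.map_mono (IntermediateField.fixingSubgroup_antitone bot_le)) hz
      have hiso := SatoTate.mul_inv_mem_Iso hc hzc
      exact ⟨z, hz, ⟨⟨c, hzc⟩, hzK⟩,
        ⟨SatoTate.Iso_le_GIso ψ hiso, Subgroup.mul_mem _ hg (Subgroup.inv_mem _ hzK)⟩, hiso⟩)
  refine ⟨⟨hn, hn₁, i, hi, ?_, ?_⟩, ⟨hL ▸ inf_le_right, hL₁ ▸ inf_le_right⟩, ?_, ?_⟩
  · have : (SatoTate.Galg₁ Ω ψ ρ L).relIndex (SatoTate.Galg₁ Ω ψ ρ ⊥) ≠ 0 := by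
      rwa [hL₁, Subgroup.inf_relIndex_right]
    have : ((SatoTate.Galg₁ Ω ψ ρ L).subgroupOf (SatoTate.Galg₁ Ω ψ ρ ⊥)).FiniteIndex := ⟨this⟩
    exact Subgroup.finite_quotient_of_finiteIndex
  · have : (SatoTate.Galg Ω ψ ρ L).relIndex (SatoTate.Galg Ω ψ ρ ⊥) ≠ 0 := by
      rwa [hL, Subgroup.inf_relIndex_right]
    have : ((SatoTate.Galg Ω ψ ρ L).subgroupOf (SatoTate.Galg Ω ψ ρ ⊥)).FiniteIndex := ⟨this⟩
    exact Subgroup.finite_quotient_of_finiteIndex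
  · rw [hL]
    exact SatoTate.identityComponent_inf_eq (SatoTate.isClosed_zariskiClosure _) hrel
  · rw [hL₁]
    exact SatoTate.identityComponent_inf_eq (SatoTate.isClosed_zariskiClosure _) hrel₁
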